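/- A ternary tree mapping on $N$ qubits is a full ordered ternary tree (every node has either no child, and is called a leaf, or a left, a middle and a right child, and is called a parent) with $N$ parents labelled bijectively by the qubits $1,\dots,N$ and $2N+1$ leaves labelled bijectively by $1,\dots,2N+1$. The leaf labelled $j$ determines a Pauli string $\gamma_j$: along the path from the root to the leaf, passing from the parent $k$ to its left, middle or right child contributes the factor $X_k$, $Y_k$ or $Z_k$, respectively. A unitary $\phi$ from the Fock space of $N$ fermionic modes to the space of $N$ qubits realizes the mapping if $\phi\, a_k\, \phi^{-1}=\tfrac12(\gamma_{2k-1}+i\gamma_{2k})$ for $1\le k\le N$, where $a_k$ are the fermionic annihilation operators; this determines $\phi$ up to a global phase. The mapping is binary-shaped if all parents lie in the binary subtree, which consists of the root and, recursively, all left and right children of its nodes. A $\mathrm{CNOT}$ circuit of depth $d$ on $N$ qubits (no ancillas) is a sequence of $d$ layers, each consisting of $\mathrm{CNOT}$ gates acting on pairwise disjoint pairs of qubits. **Theorem.** There is a constant $K$ such that for every $N\ge 1$ and any two binary-shaped ternary tree mappings $T_1,T_2$ on $N$ qubits whose leaf labels, read from left to right, form the same sequence (the qubit labels may be arbitrary),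 there is a $\mathrm{CNOT}$ circuit of depth at most $K\log N$ that transforms $T_1$ into $T_2$; that is, its unitary $U$ satisfies $U\gamma_j^{T_1}U^\dagger=\gamma_j^{T_2}$ for all $j=1,\dots,2N+1$, and $\phi_2=U\phi_1$ up to a global phase whenever $\phi_1$ realizes $T_1$ and $\phi_2$ realizes $T_2$. -/

import Mathlib

/-- Full ordered ternary trees: every node is a leaf (carrying a label in `β`) or a parent
(carrying a label in `α`) with a left, a middle and a right child. -/
inductive TernaryTree (α β : Type) : Type
  | leaf (label : β) : TernaryTree α β
  | node (label : α) (left middle right : TernaryTree α β) : TernaryTree α β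

/-- The single-qubit Pauli letters. -/
inductive Pauli : Type
  | I
  | X
  | Y
  | Z

namespace TernaryTree

variable {α β : Type}

/-- The labels of the parents (qubit nodes). -/
def qubits : TernaryTree α β → List α
  | leaf _ => []
  | node k l m r => k :: (l.qubits ++ m.qubits ++ r.qubits)

/-- The labels of the leaves, read from left to right. -/
def leaves : TernaryTree α β → List β
  | leaf j => [j]
  | node _ l m r => l.leaves ++ m.leaves ++ r.leaves

/-- The labels of the parents that lie in the binary subtree, which consists of the root and,
recursively, of all left and right children of its nodes. -/
def binaryQubits : TernaryTree α β → List α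
  | leaf _ => []
  | node k l _ r => k :: (l.binaryQubits ++ r.binaryQubits)

/-- The Pauli string of the leaf labelled `j`: along the path from the root to that leaf, passing
from the parent `k` to its left, middle or right child puts `X`, `Y` or `Z` on qubit `k`;
the qubits off the path carry `I`. (Used for trees without repeated labels.) -/
def pauliString [DecidableEq α] [DecidableEq β] : TernaryTree α β → β → (α → Pauli)
  | leaf _, _ => fun _ => Pauli.I
  | node k l m r, j =>
      if j ∈ l.leaves then Function.update (l.pauliString j) k Pauli.X
      else if j ∈ m.leaves then Function.update (m.pauliString j) k Pauli.Y
      else if j ∈ r.leaves then Function.update (r.pauliString j) k Pauli.Z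
      else fun _ => Pauli.I

end TernaryTree

/-- A ternary tree mapping on `N` qubits: a full ordered ternary tree whose parents are labelled
bijectively by `0, …, N - 1` and whose leaves are labelled bijectively by `0, …, 2N`. -/
structure TernaryTreeMapping (N : ℕ) where
  tree : TernaryTree (Fin N) (Fin (2 * N + 1))
  qubits_count : ∀ k : Fin N, tree.qubits.count k = 1
  leaves_count : ∀ j : Fin (2 * N + 1), tree.leaves.count j = 1

/-- All qubit nodes lie in the binary subtree. -/
def TernaryTreeMapping.IsBinaryShaped {N : ℕ} (T : TernaryTreeMapping N) : Prop :=
  ∀ k ∈ T.tree.qubits, k ∈ T.tree.binaryQubits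

/-- Basis labels: bit strings of length `N`. They index both the computational basis of `N` qubits
and the Fock basis of `N` fermionic modes. -/
abbrev Bits (N : ℕ) : Type := Fin N → Fin 2

/-- Operators, written as matrices in the bases indexed by bit strings. -/
abbrev Operator (N : ℕ) : Type := Matrix (Bits N) (Bits N) ℂ

/-- The `2 × 2` Pauli matrices. -/
def Pauli.toMatrix : Pauli → Matrix (Fin 2) (Fin 2) ℂ
  | Pauli.I => 1
  | Pauli.X => !![0, 1; 1, 0]
  | Pauli.Y => !![0, -Complex.I; Complex.I, 0]
  | Pauli.Z => !![1, 0; 0, -1]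

/-- The tensor product of the Pauli matrices of a Pauli string. -/
def pauliOperator {N : ℕ} (P : Fin N → Pauli) : Operator N :=
  fun y x => ∏ k, (P k).toMatrix (y k) (x k)

/-- The Majorana operator attached to the leaf labelled `j`. -/
def TernaryTreeMapping.majorana {N : ℕ} (T : TernaryTreeMapping N) (j : Fin (2 * N + 1)) :
    Operator N :=
  pauliOperator (T.tree.pauliString j)

/-- The fermionic annihilation operator `a_k` in the Fock basis:
`a_k |x⟩ = (-1)^(x_0 + ⋯ + x_{k-1}) |x with x_k replaced by 0⟩` if `x_k = 1`,
and `a_k |x⟩ = 0` if `x_k = 0`. -/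
def annihilation {N : ℕ} (k : Fin N) : Operator N :=
  fun y x => if x k = 1 ∧ y = Function.update x k 0 then
    (-1) ^ (∑ j ∈ Finset.Iio k, (x j : ℕ)) else 0

/-- `φ` is a fermion-to-qubit mapping (a unitary from Fock space to qubit space) that realizes the
ternary tree mapping `T`: it carries `a_k` to `(γ_{2k} + i γ_{2k+1}) / 2` (labels start at `0`). -/
def TernaryTreeMapping.IsRealizedBy {N : ℕ} (T : TernaryTreeMapping N) (φ : Operator N) : Prop :=
  φ ∈ Matrix.unitaryGroup (Bits N) ℂ ∧
  ∀ k : Fin N,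
    ((1 / 2 : ℂ) • (T.majorana ⟨2 * k, by omega⟩
        + Complex.I • T.majorana ⟨2 * k + 1, by omega⟩)) * φ
      = φ * annihilation k

/-- The gate `CNOT` with control `c` and target `t`: `|x⟩ ↦ |x with x_t replaced by x_t ⊕ x_c⟩`. -/
def cnot {N : ℕ} (c t : Fin N) : Operator N :=
  fun y x => if y = Function.update x t (x t + x c) then 1 else 0

/-- A layer of `CNOT` gates, given as (control, target) pairs. No qubit occurs twice: control and
target of each gate differ and different gates act on disjoint sets of qubits. -/
structure CNOTLayer (N : ℕ) where
  gates : List (Fin N × Fin N)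
  disjoint : (gates.flatMap fun g => [g.1, g.2]).Nodup

/-- The unitary of a layer (its gates commute). -/
def CNOTLayer.toOperator {N : ℕ} (L : CNOTLayer N) : Operator N :=
  (L.gates.map fun g => cnot g.1 g.2).prod

/-- A `CNOT` circuit without ancillas: a sequence of layers, the first one being applied first. -/
abbrev CNOTCircuit (N : ℕ) : Type := List (CNOTLayer N)

/-- The unitary of a circuit. -/
def CNOTCircuit.toOperator {N : ℕ} : CNOTCircuit N → Operator N
  | [] => 1
  | L :: C => CNOTCircuit.toOperator C * L.toOperator

/-- The depth of a circuit is its number of layers. -/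
def CNOTCircuit.depth {N : ℕ} (C : CNOTCircuit N) : ℕ := List.length C

/-- The operator `U` transforms the ternary tree mapping `T₁` into `T₂`: conjugation by `U` carries
each Majorana operator of `T₁` to the one of `T₂` with the same label, and on states
`φ₂ = U φ₁` for all fermion-to-qubit mappings `φ₁`, `φ₂` realizing `T₁`, `T₂`, up to the global
phase that a ternary tree leaves free. -/
def Transforms {N : ℕ} (U : Operator N) (T₁ T₂ : TernaryTreeMapping N) : Prop :=
  (∀ j, U * T₁.majorana j * U.conjTranspose = T₂.majorana j) ∧
  ∀ φ₁ φ₂ : Operator N, T₁.IsRealizedBy φ₁ → T₂.IsRealizedBy φ₂ →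
    ∃ z : ℂ, ‖z‖ = 1 ∧ φ₂ = z • (U * φ₁)

/-! In a binary-shaped tree every middle child is a leaf, so the parents form a binary tree whose
symmetric order enumerates the qubits. Write a basis state as `y`, where `y k` is `x k` plus the sum
of `x` over the left subtree of `k` (`KeyTree.IsLeftSum`). In the coordinates `x`, read in symmetric
order, the Majorana operator of the `p`-th leaf (counted from 0) flips the single bit `p / 2`
(`isLeftSum_xBit`) and multiplies by `I ^ (p % 2)` and by the sign of the first `(p + 1) / 2` bits
(`pauliPhase_eq`). The shape of the tree no longer matters.

Hence `U` can be the inverse left-sum map of `T₁`, then the permutation matching the two symmetric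
orders, then the left-sum map of `T₂` (`transforms_of_circuit`). A permutation is a product of two
involutions, each made of three layers. Left sums are computed by tree contraction
(`exists_contracts`, `Contracts.isLeftSum`): disjoint parent-child pairs are fused in parallel, the
left sums of the smaller tree are computed recursively, and the fusions are undone. A round costs
three layers and removes at least a sixth of the keys, so the depth is logarithmic
(`exists_circuit_isLeftSum`).

For states, `φ₂† U φ₁` commutes with all annihilation operators and is therefore a scalar. -/

/-! ### CNOT circuits as linear maps on bit strings -/

/-- The action of a `CNOT` gate on bit strings. -/
def cnotAct {N : ℕ} (g : Fin N × Fin N) (x : Bits N) : Bits N :=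
  Function.update x g.2 (x g.2 + x g.1)

/-- The action of a product of `CNOT` gates on bit strings. -/
def gatesAct {N : ℕ} (G : List (Fin N × Fin N)) (x : Bits N) : Bits N :=
  G.foldr cnotAct x

/-- The action of a circuit on bit strings. -/
def circuitAct {N : ℕ} : CNOTCircuit N → Bits N → Bits N
  | [], x => x
  | L :: C, x => circuitAct C (gatesAct L.gates x)

/-- The operator that permutes the computational basis by `f`. -/
def basisMap {N : ℕ} (f : Bits N → Bits N) : Operator N :=
  fun y x => if y = f x then 1 else 0

section Circuits

variable {N : ℕ}

theorem Fin.two_add_self (a : Fin 2) : a + a = 0 := by revert a; decide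

theorem basisMap_mul (f g : Bits N → Bits N) :
    basisMap f * basisMap g = basisMap (f ∘ g) := by
  ext y x
  simp [Matrix.mul_apply, basisMap]

theorem basisMap_id : basisMap (id : Bits N → Bits N) = 1 := by
  ext y x
  simp [basisMap, Matrix.one_apply]

theorem CNOTLayer.toOperator_eq (L : CNOTLayer N) :
    L.toOperator = basisMap (gatesAct L.gates) := by
  obtain ⟨G, hG⟩ := L
  simp only [CNOTLayer.toOperator]
  clear hG
  induction G with
  | nil => exact basisMap_id.symm
  | cons g G ih =>
    rw [List.map_cons, List.prod_cons, ih]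
    exact basisMap_mul (cnotAct g) (gatesAct G)

theorem CNOTCircuit.toOperator_eq (C : CNOTCircuit N) :
    C.toOperator = basisMap (circuitAct C) := by
  induction C with
  | nil => exact basisMap_id.symm
  | cons L C ih =>
    rw [CNOTCircuit.toOperator, ih, L.toOperator_eq, basisMap_mul]
    rfl

theorem cnotAct_add (g : Fin N × Fin N) (x y : Bits N) :
    cnotAct g (x + y) = cnotAct g x + cnotAct g y := by
  ext a
  by_cases h : a = g.2
  · subst h; simp [cnotAct, add_add_add_comm]
  · simp [cnotAct, h]

theorem gatesAct_add (G : List (Fin N × Fin N)) (x y : Bits N) :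
    gatesAct G (x + y) = gatesAct G x + gatesAct G y := by
  induction G with
  | nil => rfl
  | cons g G ih =>
    change cnotAct g (gatesAct G (x + y)) = cnotAct g (gatesAct G x) + cnotAct g (gatesAct G y)
    rw [ih, cnotAct_add]

theorem circuitAct_add (C : CNOTCircuit N) (x y : Bits N) :
    circuitAct C (x + y) = circuitAct C x + circuitAct C y := by
  induction C generalizing x y with
  | nil => rfl
  | cons L C ih => simp only [circuitAct, gatesAct_add, ih]

theorem circuitAct_append (C D : CNOTCircuit N) (x : Bits N) :
    circuitAct (C ++ D) x = circuitAct D (circuitAct C x) := by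
  induction C generalizing x with
  | nil => rfl
  | cons L C ih => exact ih _

theorem gatesAct_of_not_target (G : List (Fin N × Fin N)) (x : Bits N) (a : Fin N)
    (h : ∀ g ∈ G, g.2 ≠ a) : gatesAct G x a = x a := by
  induction G with
  | nil => rfl
  | cons g G ih =>
    change cnotAct g (gatesAct G x) a = x a
    rw [cnotAct, Function.update_of_ne (h g (by simp)).symm]
    exact ih fun g hg => h g (by simp [hg])

/-- No qubit occurs twice in the list of gates. -/
def DisjointGates (G : List (Fin N × Fin N)) : Prop :=
  (G.flatMap fun g => [g.1, g.2]).Nodup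

theorem disjointGates_cons {g : Fin N × Fin N} {G : List (Fin N × Fin N)} :
    DisjointGates (g :: G) ↔
      g.1 ≠ g.2 ∧ (∀ h ∈ G, g.1 ≠ h.1 ∧ g.1 ≠ h.2 ∧ g.2 ≠ h.1 ∧ g.2 ≠ h.2) ∧
        DisjointGates G := by
  simp only [DisjointGates, List.flatMap_cons, List.cons_append, List.nil_append,
    List.nodup_cons, List.mem_cons, List.mem_flatMap, List.not_mem_nil, or_false]
  grind

theorem DisjointGates.map_swap {G : List (Fin N × Fin N)} (h : DisjointGates G) :
    DisjointGates (G.map Prod.swap) := by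
  induction G with
  | nil => exact h
  | cons g G ih =>
    rw [disjointGates_cons] at h
    rw [List.map_cons, disjointGates_cons]
    refine ⟨h.1.symm, ?_, ih h.2.2⟩
    simp only [List.mem_map]
    rintro _ ⟨k, hk, rfl⟩
    have := h.2.1 k hk
    simp only [Prod.fst_swap, Prod.snd_swap]
    tauto

theorem DisjointGates.sublist {G H : List (Fin N × Fin N)} (h : DisjointGates H)
    (s : G.Sublist H) : DisjointGates G :=
  List.Nodup.sublist (s.flatMap _) h

theorem DisjointGates.control_ne_target {G : List (Fin N × Fin N)} (h : DisjointGates G)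
    {g k : Fin N × Fin N} (hg : g ∈ G) (hk : k ∈ G) : k.2 ≠ g.1 := by
  induction G with
  | nil => simp at hg
  | cons f G ih =>
    rw [disjointGates_cons] at h
    obtain ⟨h1, h2, h3⟩ := h
    rcases List.mem_cons.1 hg with rfl | hg' <;> rcases List.mem_cons.1 hk with rfl | hk'
    · exact h1.symm
    · exact (h2 k hk').2.1.symm
    · exact (h2 g hg').2.2.1
    · exact ih h3 hg' hk'

theorem DisjointGates.act_target {G : List (Fin N × Fin N)} (h : DisjointGates G)
    {g : Fin N × Fin N} (hg : g ∈ G) (x : Bits N) : gatesAct G x g.2 = x g.2 + x g.1 := by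
  induction G with
  | nil => simp at hg
  | cons f G ih =>
    change cnotAct f (gatesAct G x) g.2 = _
    have h' := disjointGates_cons.1 h
    rcases List.mem_cons.1 hg with rfl | hg
    · rw [cnotAct, Function.update_self,
        gatesAct_of_not_target G x g.2 fun k hk => (h'.2.1 k hk).2.2.2.symm,
        gatesAct_of_not_target G x g.1 fun k hk => (h'.2.1 k hk).2.1.symm]
    · rw [cnotAct, Function.update_of_ne (h'.2.1 g hg).2.2.2.symm, ih h'.2.2 hg]

theorem DisjointGates.act_control {G : List (Fin N × Fin N)} (h : DisjointGates G)
    {g : Fin N × Fin N} (hg : g ∈ G) (x : Bits N) : gatesAct G x g.1 = x g.1 :=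
  gatesAct_of_not_target G x g.1 fun _ hk => h.control_ne_target hg hk

theorem DisjointGates.act_act {G : List (Fin N × Fin N)} (h : DisjointGates G) (x : Bits N) :
    gatesAct G (gatesAct G x) = x := by
  ext1 a
  by_cases ha : ∃ g ∈ G, g.2 = a
  · obtain ⟨g, hg, rfl⟩ := ha
    rw [h.act_target hg, h.act_target hg, h.act_control hg, add_assoc, Fin.two_add_self, add_zero]
  · push Not at ha
    rw [gatesAct_of_not_target G _ a ha, gatesAct_of_not_target G _ a ha]

/-- Each layer is an involution, since none of its controls is a target. Reversal therefore inverts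
a circuit at no cost in depth. -/
theorem circuitAct_reverse (C : CNOTCircuit N) (x : Bits N) :
    circuitAct C.reverse (circuitAct C x) = x := by
  induction C generalizing x with
  | nil => rfl
  | cons L C ih =>
    rw [List.reverse_cons, circuitAct_append]
    simp only [circuitAct, ih]
    exact DisjointGates.act_act L.disjoint x

theorem circuitAct_surjective (C : CNOTCircuit N) : Function.Surjective (circuitAct C) := fun x =>
  ⟨circuitAct C.reverse x, by simpa using circuitAct_reverse C.reverse x⟩

theorem circuitAct_injective (C : CNOTCircuit N) : Function.Injective (circuitAct C) :=
  Function.LeftInverse.injective (circuitAct_reverse C)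

theorem CNOTCircuit.toOperator_mem_unitaryGroup (C : CNOTCircuit N) :
    C.toOperator ∈ Matrix.unitaryGroup (Bits N) ℂ := by
  rw [Matrix.mem_unitaryGroup_iff', C.toOperator_eq]
  ext y x
  have := (circuitAct_injective C).eq_iff (a := x) (b := y)
  simp [Matrix.star_eq_conjTranspose, Matrix.mul_apply, basisMap, Matrix.one_apply, this, eq_comm,
    Matrix.conjTranspose_apply, apply_ite (star : ℂ → ℂ)]

/-! ### Qubit permutations in constant depth -/

/-- An involution of the qubits is a circuit of three layers. -/
theorem exists_circuit_of_involutive (τ : Fin N → Fin N) (hτ : ∀ a, τ (τ a) = a) :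
    ∃ C : CNOTCircuit N, C.length = 3 ∧ ∀ x, circuitAct C x = x ∘ τ := by
  have key : ∀ l : List (Fin N), l.Nodup → (∀ a ∈ l, a < τ a) →
      DisjointGates (l.map fun a => (a, τ a)) := by
    intro l
    induction l with
    | nil => intro _ _; exact List.nodup_nil
    | cons a l ih =>
      intro h1 h2
      rw [List.map_cons, disjointGates_cons]
      rw [List.nodup_cons] at h1
      refine ⟨(h2 a (by simp)).ne, ?_, ih h1.2 fun b hb => h2 b (by simp [hb])⟩
      simp only [List.mem_map]
      rintro _ ⟨b, hb, rfl⟩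
      have hab : a ≠ b := fun e => h1.1 (e ▸ hb)
      have ha := h2 a (by simp)
      have hb := h2 b (by simp [hb])
      have ha' := hτ a
      have hb' := hτ b
      refine ⟨hab, ?_, ?_, ?_⟩ <;> rintro e <;> simp only at e
      · subst e; rw [hb'] at ha; exact lt_asymm ha hb
      · subst e; rw [ha'] at hb; exact lt_asymm ha hb
      · exact hab (by rw [← ha', e, hb'])
  set l := (Finset.univ.filter fun a => a < τ a).toList
  have hl : ∀ a, a ∈ l ↔ a < τ a := by simp [l]
  have hG := key l (Finset.nodup_toList _) fun a ha => (hl a).1 ha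
  set G := l.map fun a => (a, τ a)
  have hG' := hG.map_swap
  have hm : ∀ a, a < τ a → (a, τ a) ∈ G := fun a ha => List.mem_map.2 ⟨a, (hl a).2 ha, rfl⟩
  have hm' : ∀ a, a < τ a → (τ a, a) ∈ G.map Prod.swap := fun a ha =>
    List.mem_map.2 ⟨_, hm a ha, rfl⟩
  -- Three alternating CNOTs swap two qubits; listing each 2-cycle once, by its smaller element,
  -- makes the gates disjoint.
  refine ⟨[⟨G, hG⟩, ⟨G.map Prod.swap, hG'⟩, ⟨G, hG⟩], rfl, fun x => ?_⟩
  have main : ∀ a, a < τ a →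
      gatesAct G (gatesAct (G.map Prod.swap) (gatesAct G x)) a = x (τ a) ∧
      gatesAct G (gatesAct (G.map Prod.swap) (gatesAct G x)) (τ a) = x a := by
    intro a ha
    have t1 := fun x => hG.act_target (hm a ha) x
    have c1 := fun x => hG.act_control (hm a ha) x
    have t2 := fun x => hG'.act_target (hm' a ha) x
    have c2 := fun x => hG'.act_control (hm' a ha) x
    simp only at t1 c1 t2 c2
    simp only [t1, c1, t2, c2]
    generalize x a = u
    generalize x (τ a) = v
    revert u v
    decide
  ext1 a
  simp only [circuitAct, Function.comp]
  rcases lt_trichotomy a (τ a) with h | h | h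
  · exact (main a h).1
  · have h1 : ∀ g ∈ G, g.1 ≠ a ∧ g.2 ≠ a := by
      intro g hg
      obtain ⟨b, hb, rfl⟩ := List.mem_map.1 hg
      rw [hl] at hb
      constructor
      · rintro rfl; exact hb.ne h
      · rintro e; simp only at e; rw [← e, hτ] at h; exact hb.ne h.symm
    have h2 : ∀ g ∈ G.map Prod.swap, g.2 ≠ a := by
      intro g hg
      obtain ⟨b, hb, rfl⟩ := List.mem_map.1 hg
      exact (h1 b hb).1
    rw [gatesAct_of_not_target _ _ _ fun g hg => (h1 g hg).2, gatesAct_of_not_target _ _ _ h2,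
      gatesAct_of_not_target _ _ _ fun g hg => (h1 g hg).2, ← h]
  · have := (main (τ a) (by rwa [hτ])).2
    rwa [hτ] at this

/-- Every permutation is a product of two involutions. -/
theorem Equiv.Perm.exists_involutive_comp {α : Type*} (π : Equiv.Perm α) :
    ∃ σ τ : α → α, (∀ a, σ (σ a) = a) ∧ (∀ a, τ (τ a) = a) ∧ ∀ a, π a = σ (τ a) := by
  let S := Equiv.Perm.SameCycle.setoid π
  let r : α → α := fun a => (Quotient.mk S a).out
  have hr : ∀ a, ∃ i : ℤ, (π ^ i) (r a) = a := fun a => Quotient.mk_out (s := S) a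
  have hrr : ∀ (i : ℤ) a, r ((π ^ i) a) = r a := fun i a =>
    congrArg Quotient.out (Quotient.sound (s := S) (show π.SameCycle _ _ from
      (Equiv.Perm.SameCycle.symm ⟨i, rfl⟩)))
  choose i hi using hr
  -- Reflection of each cycle about its representative: `π ^ i r` goes to `π ^ (-i) r`.
  let τ : α → α := fun a => (π ^ (-i a)) (r a)
  have hrτ : ∀ a, r (r a) = r a := fun a => by
    conv_lhs => rw [← hrr (i a) (r a), hi]
  -- On a finite cycle the chosen exponent may differ from `j`; the reflection does not depend on
  -- the choice.
  have key : ∀ (j : ℤ) a, τ ((π ^ j) (r a)) = (π ^ (-j)) (r a) := by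
    intro j a
    have h := hi ((π ^ j) (r a))
    simp only [τ, hrr, hrτ] at h ⊢
    generalize i ((π ^ j) (r a)) = k at h ⊢
    have h2 : (π ^ (-k - j)) ((π ^ k) (r a)) = (π ^ (-k - j)) ((π ^ j) (r a)) := by rw [h]
    rw [← Equiv.Perm.mul_apply, ← Equiv.Perm.mul_apply, ← zpow_add, ← zpow_add,
      sub_add_cancel, sub_add_eq_add_sub, neg_add_cancel, zero_sub] at h2
    exact h2.symm
  have hτ : ∀ a, τ (τ a) = a := fun a => by
    change τ ((π ^ (-i a)) (r a)) = a
    rw [key, neg_neg, hi]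
  -- `π ∘ τ` sends `π ^ i r` to `π ^ (1 - i) r`, which is again a reflection.
  refine ⟨fun a => π (τ a), τ, fun a => ?_, hτ, fun a => by simp only [hτ]⟩
  have : π (τ a) = (π ^ (1 - i a)) (r a) := by
    rw [sub_eq_add_neg, zpow_add, zpow_one, Equiv.Perm.mul_apply]
  simp only
  rw [this, key, ← Equiv.Perm.mul_apply, ← zpow_one_add]
  simpa using hi a

/-- The case `N = 1` is singled out because `log 1 = 0` leaves no room for any layer. -/
theorem exists_circuit_of_perm (π : Equiv.Perm (Fin N)) :
    ∃ C : CNOTCircuit N, C.length ≤ 6 ∧ (N = 1 → C.length = 0) ∧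
      ∀ x, circuitAct C x = x ∘ π := by
  by_cases hN : N = 1
  · subst hN
    exact ⟨[], by simp, fun _ => rfl, fun x => by rw [Subsingleton.elim π 1]; rfl⟩
  obtain ⟨σ, τ, hσ, hτ, h⟩ := Equiv.Perm.exists_involutive_comp π
  obtain ⟨C, hC, hC'⟩ := exists_circuit_of_involutive σ hσ
  obtain ⟨D, hD, hD'⟩ := exists_circuit_of_involutive τ hτ
  refine ⟨C ++ D, by simp [hC, hD], fun e => absurd e hN, fun x => ?_⟩
  rw [circuitAct_append, hC', hD']
  ext1 a
  simp [h]

end Circuits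

/-! ### Left sums and contraction of binary trees -/

/-- Binary trees whose inner nodes carry keys. -/
inductive KeyTree (V : Type) : Type
  | nil : KeyTree V
  | node (k : V) (l r : KeyTree V) : KeyTree V

/-- A pair of keys that is to be fused: the first one is removed and the second one is kept. The
flags tell which of the gates `removed → kept` and `kept → removed` are needed afterwards. -/
structure Fusion (V : Type) : Type where
  removed : V
  kept : V
  forth : Bool
  back : Bool

namespace KeyTree

variable {V : Type}

/-- The keys in symmetric order. -/
def keys : KeyTree V → List V
  | nil => []
  | node k l r => l.keys ++ k :: r.keys

/-- The sum of the values of all keys. -/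
def sum (x : V → Fin 2) : KeyTree V → Fin 2
  | nil => 0
  | node k l r => l.sum x + x k + r.sum x

/-- At every key, `y` is the value of `x` plus the sum of `x` over the left subtree. -/
def IsLeftSum (x y : V → Fin 2) : KeyTree V → Prop
  | nil => True
  | node k l r => y k = l.sum x + x k ∧ l.IsLeftSum x y ∧ r.IsLeftSum x y

theorem sum_eq (x : V → Fin 2) (T : KeyTree V) : T.sum x = (T.keys.map x).sum := by
  induction T with
  | nil => rfl
  | node k l r hl hr => simp [sum, keys, hl, hr, add_assoc]

theorem IsLeftSum.unique {x y z : V → Fin 2} {T : KeyTree V} (h : T.IsLeftSum x y)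
    (h' : T.IsLeftSum x z) : ∀ a ∈ T.keys, y a = z a := by
  induction T with
  | nil => simp [keys]
  | node k l r hl hr =>
    intro a ha
    simp only [keys, List.mem_append, List.mem_cons] at ha
    rcases ha with ha | rfl | ha
    · exact hl h.2.1 h'.2.1 a ha
    · exact h.1.trans h'.1.symm
    · exact hr h.2.2 h'.2.2 a ha

theorem IsLeftSum.congr {x x' y y' : V → Fin 2} {T : KeyTree V} (h : T.IsLeftSum x y)
    (hx : ∀ a ∈ T.keys, x a = x' a) (hy : ∀ a ∈ T.keys, y a = y' a) : T.IsLeftSum x' y' := by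
  induction T with
  | nil => trivial
  | node k l r hl hr =>
    simp only [keys, List.mem_append, List.mem_cons] at hx hy
    refine ⟨?_, hl h.2.1 (fun a ha => hx a (.inl ha)) fun a ha => hy a (.inl ha),
      hr h.2.2 (fun a ha => hx a (.inr (.inr ha))) fun a ha => hy a (.inr (.inr ha))⟩
    rw [← hy k (.inr (.inl rfl)), h.1, hx k (.inr (.inl rfl)), sum_eq, sum_eq,
      List.map_congr_left fun a ha => hx a (.inl ha)]

/-- `T.Contracts T' M U`: fusing the pairs `M` of adjacent keys turns `T` into `T'`; the keys `U`
are not involved. -/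
inductive Contracts : KeyTree V → KeyTree V → List (Fusion V) → List V → Prop
  | nil : Contracts nil nil [] []
  | node (k : V) {l l' r r' : KeyTree V} {L M : List (Fusion V)} {U W : List V} :
      Contracts l l' L U → Contracts r r' M W →
      Contracts (node k l r) (node k l' r') (L ++ M) (k :: (U ++ W))
  | leftRight (p c : V) {l l' r r' : KeyTree V} {L M : List (Fusion V)} {U W : List V} :
      Contracts l l' L U → Contracts r r' M W →
      Contracts (node p (node c .nil l) r) (node p l' r') (⟨c, p, false, false⟩ :: (L ++ M))
        (U ++ W)
  | leftLeft (p c : V) {l l' r r' : KeyTree V} {L M : List (Fusion V)} {U W : List V} :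
      Contracts l l' L U → Contracts r r' M W →
      Contracts (node p (node c l .nil) r) (node c l' r') (⟨p, c, true, true⟩ :: (L ++ M))
        (U ++ W)
  | right (p c : V) {l l' r r' : KeyTree V} {L M : List (Fusion V)} {U W : List V} :
      Contracts l l' L U → Contracts r r' M W →
      Contracts (node p .nil (node c l r)) (node c l' r') (⟨p, c, true, false⟩ :: (L ++ M))
        (U ++ W)
  | rightRight (p c : V) {l l' r r' : KeyTree V} {L M : List (Fusion V)} {U W : List V} :
      Contracts l l' L U → Contracts r r' M W →
      Contracts (node p l (node c .nil r)) (node p l' r') (⟨c, p, true, false⟩ :: (L ++ M))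
        (U ++ W)

/-- For distinct keys this makes the fused pairs disjoint, so that each round fits into layers, and
it counts the surviving keys. -/
theorem Contracts.keys_perm {T T' : KeyTree V} {M : List (Fusion V)} {U : List V}
    (h : T.Contracts T' M U) :
    T.keys.Perm (M.map Fusion.removed ++ M.map Fusion.kept ++ U) ∧
      T'.keys.Perm (M.map Fusion.kept ++ U) := by
  simp only [← Multiset.coe_eq_coe]
  induction h with
  | nil => exact ⟨rfl, rfl⟩
  | node k _ _ h1 h2 | leftRight p c _ _ h1 h2 | leftLeft p c _ _ h1 h2 | right p c _ _ h1 h2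
  | rightRight p c _ _ h1 h2 =>
    obtain ⟨h1, h1'⟩ := h1
    obtain ⟨h2, h2'⟩ := h2
    simp only [keys, List.map_cons, List.map_append, List.cons_append, ← Multiset.coe_add,
      ← Multiset.cons_coe, ← Multiset.singleton_add, Multiset.coe_nil] at *
    rw [h1, h2, h1', h2']
    constructor <;> abel

theorem Contracts.refl (T : KeyTree V) : ∃ U, T.Contracts T [] U := by
  induction T with
  | nil => exact ⟨_, .nil⟩
  | node k l r hl hr => exact ⟨_, .node k hl.choose_spec hr.choose_spec⟩

/-- The number of children of the root. -/
def rootDegree : KeyTree V → ℕ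
  | nil => 0
  | node _ l r => min 1 l.keys.length + min 1 r.keys.length

theorem keys_length_eq_zero {T : KeyTree V} : T.keys.length = 0 ↔ T = nil := by
  cases T <;> simp [keys]

/-- Every tree can be contracted by a constant fraction. -/
theorem exists_contracts (n : ℕ) : ∀ T : KeyTree V, T.keys.length ≤ n → ∃ T' M U, T.Contracts T' M U ∧
    (2 ≤ T.keys.length → T.keys.length + 2 ≤ 6 * M.length) ∧
    (T.rootDegree = 2 → T.keys.length + 3 ≤ 6 * M.length) := by
  induction n with
  | zero =>
    intro T hT
    rw [Nat.le_zero, keys_length_eq_zero] at hT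
    subst hT
    exact ⟨_, _, _, .nil, by simp [keys], by simp [rootDegree]⟩
  | succ n ih =>
    rintro (_ | ⟨p, l, r⟩) hT
    · exact ⟨_, _, _, .nil, by simp [keys], by simp [rootDegree]⟩
    rcases l with _ | ⟨c, A, B⟩
    · rcases r with _ | ⟨d, C, D⟩
      · exact ⟨_, _, _, (Contracts.refl _).choose_spec, by simp [keys], by simp [rootDegree, keys]⟩
      simp only [keys, List.length_append, List.length_cons, List.length_nil] at hT
      by_cases hCD : C.keys.length = 0 ∨ D.keys.length = 0
      · obtain ⟨C', L, _, hC, hC1, -⟩ := ih C (by omega)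
        obtain ⟨D', M, _, hD, hD1, -⟩ := ih D (by omega)
        refine ⟨_, _, _, .right p d hC hD, ?_, ?_⟩ <;>
          simp [keys, rootDegree] <;> omega
      -- The only child has two children: leaving `p` unfused costs one key, which the stronger
      -- bound for root degree 2 pays for.
      · obtain ⟨T', M, _, hT', -, hM⟩ := ih (.node d C D)
          (by simp [keys]; omega)
        refine ⟨_, _, _, .node p .nil hT', ?_, ?_⟩ <;>
          simp [keys, rootDegree] at hM ⊢ <;> omega
    rcases r with _ | ⟨d, C, D⟩
    · simp only [keys, List.length_append, List.length_cons, List.length_nil] at hT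
      obtain ⟨A', L, _, hA, hA1, -⟩ := ih A (by omega)
      obtain ⟨B', M, _, hB, hB1, -⟩ := ih B (by omega)
      rcases A with _ | ⟨a, A1, A2⟩
      · refine ⟨_, _, _, .leftRight p c hB .nil, ?_, ?_⟩ <;>
          simp [keys, rootDegree] <;> omega
      rcases B with _ | ⟨b, B1, B2⟩
      · refine ⟨_, _, _, .leftLeft p c hA .nil, ?_, ?_⟩ <;>
          simp [keys, rootDegree] at * <;> omega
      · obtain ⟨T', M, _, hT', -, hM⟩ := ih (.node c (.node a A1 A2) (.node b B1 B2))
          (by simp [keys] at *; omega)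
        refine ⟨_, _, _, .node p hT' .nil, ?_, ?_⟩ <;>
          simp [keys, rootDegree] at hM ⊢ <;> omega
    · simp only [keys, List.length_append, List.length_cons] at hT
      obtain ⟨l', L, _, hl, hl1, -⟩ := ih (.node c A B) (by simp [keys]; omega)
      obtain ⟨r', M, _, hr, hr1, -⟩ := ih (.node d C D) (by simp [keys]; omega)
      by_cases hAB : A.keys.length = 0 ∧ B.keys.length = 0
      · obtain ⟨rfl, rfl⟩ := hAB.imp keys_length_eq_zero.1 keys_length_eq_zero.1
        refine ⟨_, _, _, .leftRight p c .nil hr, ?_, ?_⟩ <;>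
          simp [keys, rootDegree] at * <;> omega
      by_cases hCD : C.keys.length = 0 ∧ D.keys.length = 0
      · obtain ⟨rfl, rfl⟩ := hCD.imp keys_length_eq_zero.1 keys_length_eq_zero.1
        refine ⟨_, _, _, .rightRight p d hl .nil, ?_, ?_⟩ <;>
          simp [keys, rootDegree] at * <;> omega
      -- Both subtrees have at least two keys; their two surpluses of 2, less one for `p`, give the
      -- surplus 3.
      · refine ⟨_, _, _, .node p hl hr, ?_, ?_⟩ <;>
          simp [keys, rootDegree] at hl1 hr1 ⊢ <;> omega

/-- The relation between the bit strings `x`, `x'` before and after the first layer of a round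
of fusions, and between the strings `z`, `y` before and after its last two layers. -/
structure RoundAct (x x' z y : V → Fin 2) (f : Fusion V) : Prop where
  x_removed : x' f.removed = x f.removed
  x_kept : x' f.kept = x f.kept + x f.removed
  z_removed : z f.removed = x' f.removed
  y_kept : y f.kept = if f.forth then z f.kept + z f.removed else z f.kept
  y_removed : y f.removed = if f.back then z f.removed + y f.kept else z f.removed

/-- The kept key absorbs the value of the removed one, so subtree sums survive. Afterwards `z` at
the kept key is the left sum of the fused pair. In `leftRight` this is already correct. In `right`
and `rightRight` it contains the removed value in excess, which the gate `forth` cancels. In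
`leftLeft` it belongs to the removed parent: `forth` corrects the kept child, and `back` adds the
result to the parent. -/
theorem Contracts.isLeftSum {T T' : KeyTree V} {M : List (Fusion V)} {U : List V}
    (h : T.Contracts T' M U) {x x' z y : V → Fin 2} (hM : ∀ f ∈ M, RoundAct x x' z y f)
    (hU : ∀ a ∈ U, x' a = x a ∧ y a = z a) (h' : T'.IsLeftSum x' z) :
    T'.sum x' = T.sum x ∧ T.IsLeftSum x y := by
  induction h with
  | nil => exact ⟨rfl, trivial⟩
  | node k _ _ h1 h2 =>
    simp only [List.mem_append, List.mem_cons] at hM hU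
    obtain ⟨h0, hl, hr⟩ := h'
    obtain ⟨s1, t1⟩ := h1 (fun f hf => hM f (.inl hf)) (fun a ha => hU a (.inr (.inl ha))) hl
    obtain ⟨s2, t2⟩ := h2 (fun f hf => hM f (.inr hf)) (fun a ha => hU a (.inr (.inr ha))) hr
    obtain ⟨e1, e2⟩ := hU k (.inl rfl)
    refine ⟨by simp only [sum, s1, s2, e1], ?_, t1, t2⟩
    rw [e2, h0, s1, e1]
  | leftRight p c _ _ h1 h2 | leftLeft p c _ _ h1 h2 | right p c _ _ h1 h2
  | rightRight p c _ _ h1 h2 =>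
    simp only [List.mem_append, List.mem_cons] at hM hU
    obtain ⟨h0, hl, hr⟩ := h'
    obtain ⟨s1, t1⟩ := h1 (fun f hf => hM f (.inr (.inl hf))) (fun a ha => hU a (.inl ha)) hl
    obtain ⟨s2, t2⟩ := h2 (fun f hf => hM f (.inr (.inr hf))) (fun a ha => hU a (.inr ha)) hr
    obtain ⟨e1, e2, e3, e4, e5⟩ := hM _ (.inl rfl)
    simp only [if_true, Bool.false_eq_true, if_false] at e1 e2 e3 e4 e5
    simp only [sum, IsLeftSum, t1, t2, and_true, true_and, e5, e4, e3, e1, h0, s1, s2, e2]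
    generalize x p = a
    generalize x c = b
    generalize sum x _ = s
    generalize sum x _ = t
    revert a b s t
    decide

end KeyTree

/-! ### Left sums in logarithmic depth -/

section Contraction

variable {N : ℕ}

theorem disjointGates_map_fusion {M : List (Fusion (Fin N))}
    (h : (M.map Fusion.removed ++ M.map Fusion.kept).Nodup) :
    DisjointGates (M.map fun f => (f.removed, f.kept)) := by
  refine List.Perm.nodup ?_ h
  clear h
  induction M with
  | nil => rfl
  | cons f M ih =>
    simp only [List.map_cons, List.flatMap_cons, List.cons_append, List.nil_append]
    exact (List.perm_middle.trans (ih.cons _)).cons _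

/-- One round of fusions. -/
theorem KeyTree.Contracts.exists_round {T T' : KeyTree (Fin N)} {M : List (Fusion (Fin N))}
    {U : List (Fin N)} (h : T.Contracts T' M U) (hT : T.keys.Nodup) :
    ∃ L₁ L₂ L₃ : CNOTLayer N,
      (∀ a ∉ T.keys, ∀ x, gatesAct L₁.gates x a = x a ∧ gatesAct L₂.gates x a = x a ∧
        gatesAct L₃.gates x a = x a) ∧
      ∀ (F : Bits N → Bits N), (∀ x, ∀ a ∉ T'.keys, F x a = x a) →
        (∀ x, T'.IsLeftSum x (F x)) →
        ∀ x, T.IsLeftSum x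
          (gatesAct L₃.gates (gatesAct L₂.gates (F (gatesAct L₁.gates x)))) := by
  obtain ⟨hp, hp'⟩ := h.keys_perm
  have hn := hp.nodup hT
  have hRK := (List.nodup_append.1 hn).1
  have hG := disjointGates_map_fusion hRK
  have hmem : ∀ a, a ∈ T.keys ↔ a ∈ M.map Fusion.removed ∨ a ∈ M.map Fusion.kept ∨ a ∈ U := by
    intro a
    simp only [hp.mem_iff, List.mem_append, or_assoc]
  have hU : ∀ a ∈ U, ∀ f ∈ M, f.removed ≠ a ∧ f.kept ≠ a := by
    intro a ha f hf
    have := (List.nodup_append.1 hn).2.2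
    exact ⟨this _ (List.mem_append_left _ (List.mem_map_of_mem hf)) _ ha,
      this _ (List.mem_append_right _ (List.mem_map_of_mem hf)) _ ha⟩
  have hrem : ∀ f ∈ M, f.removed ∉ T'.keys := by
    intro f hf hf'
    rw [hp'.mem_iff, List.mem_append] at hf'
    rcases hf' with hf' | hf'
    · exact (List.nodup_append.1 hRK).2.2 _ (List.mem_map_of_mem hf) _ hf' rfl
    · exact (hU _ hf' f hf).1 rfl
  have hK := (List.nodup_append.1 hRK).2.1
  have hR := (List.nodup_append.1 hRK).1
  have hne : ∀ f ∈ M, ∀ g ∈ M, f.removed ≠ g.kept := fun f hf g hg =>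
    (List.nodup_append.1 hRK).2.2 _ (List.mem_map_of_mem hf) _ (List.mem_map_of_mem hg)
  have hinjK : ∀ f ∈ M, ∀ g ∈ M, f.kept = g.kept → f = g := fun f hf g hg e =>
    List.inj_on_of_nodup_map hK hf hg e
  have hinjR : ∀ f ∈ M, ∀ g ∈ M, f.removed = g.removed → f = g := fun f hf g hg e =>
    List.inj_on_of_nodup_map hR hf hg e
  set G₁ := M.map fun f => (f.removed, f.kept) with hG₁
  have hG₂ : DisjointGates ((M.filter fun f => f.forth).map fun f => (f.removed, f.kept)) :=
    hG.sublist ((List.filter_sublist (l := M)).map _)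
  have hG₃ : DisjointGates (((M.filter fun f => f.back).map fun f => (f.removed, f.kept)).map
      Prod.swap) := (hG.sublist ((List.filter_sublist (l := M)).map _)).map_swap
  set G₂ := (M.filter fun f => f.forth).map fun f => (f.removed, f.kept) with hG₂'
  set G₃ := ((M.filter fun f => f.back).map fun f => (f.removed, f.kept)).map Prod.swap with hG₃'
  have t₁ : ∀ x a, (∀ f ∈ M, f.kept ≠ a) → gatesAct G₁ x a = x a := by
    intro x a ha
    refine gatesAct_of_not_target _ _ _ fun g hg => ?_
    obtain ⟨f, hf, rfl⟩ := List.mem_map.1 hg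
    exact ha f hf
  have t₂ : ∀ x a, (∀ f ∈ M, f.forth → f.kept ≠ a) → gatesAct G₂ x a = x a := by
    intro x a ha
    refine gatesAct_of_not_target _ _ _ fun g hg => ?_
    obtain ⟨f, hf, rfl⟩ := List.mem_map.1 hg
    exact ha f (List.mem_filter.1 hf).1 (List.mem_filter.1 hf).2
  have t₃ : ∀ x a, (∀ f ∈ M, f.back → f.removed ≠ a) → gatesAct G₃ x a = x a := by
    intro x a ha
    refine gatesAct_of_not_target _ _ _ fun g hg => ?_
    obtain ⟨k, hk, rfl⟩ := List.mem_map.1 hg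
    obtain ⟨f, hf, rfl⟩ := List.mem_map.1 hk
    exact ha f (List.mem_filter.1 hf).1 (List.mem_filter.1 hf).2
  refine ⟨⟨G₁, hG⟩, ⟨G₂, hG₂⟩, ⟨G₃, hG₃⟩, ?_, ?_⟩
  · intro a ha x
    rw [hmem] at ha
    push Not at ha
    have h1 : ∀ f ∈ M, f.removed ≠ a := fun f hf e => ha.1 (e ▸ List.mem_map_of_mem hf)
    have h2 : ∀ f ∈ M, f.kept ≠ a := fun f hf e => ha.2.1 (e ▸ List.mem_map_of_mem hf)
    exact ⟨t₁ x a h2, t₂ x a fun f hf _ => h2 f hf, t₃ x a fun f hf _ => h1 f hf⟩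
  · intro F hF hF' x
    refine (h.isLeftSum (x' := gatesAct G₁ x) (z := F (gatesAct G₁ x)) (fun f hf => ?_)
      (fun a ha => ?_) (hF' _)).2
    · have k₁ : ∀ x, gatesAct G₃ x f.kept = x f.kept := fun x =>
        t₃ x _ fun g hg _ => hne g hg f hf
      have k₂ : ∀ x, gatesAct G₂ x f.removed = x f.removed := fun x =>
        t₂ x _ fun g hg _ => (hne f hf g hg).symm
      have hy : ∀ z, gatesAct G₂ z f.kept =
          if f.forth then z f.kept + z f.removed else z f.kept := by
        intro z
        split_ifs with hb
        · exact hG₂.act_target (g := (f.removed, f.kept))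
            (List.mem_map.2 ⟨f, List.mem_filter.2 ⟨hf, hb⟩, rfl⟩) z
        · exact t₂ z _ fun g hg hgb e => hb (hinjK g hg f hf e ▸ hgb)
      refine ⟨t₁ x _ fun g hg => (hne f hf g hg).symm,
        hG.act_target (g := (f.removed, f.kept)) (List.mem_map.2 ⟨f, hf, rfl⟩) x,
        hF _ _ (hrem f hf), ?_, ?_⟩
      · rw [k₁, hy]
      · rw [k₁]
        split_ifs with hb
        · rw [hG₃.act_target (g := (f.kept, f.removed)), k₂]
          exact List.mem_map.2 ⟨(f.removed, f.kept),
            List.mem_map.2 ⟨f, List.mem_filter.2 ⟨hf, hb⟩, rfl⟩, rfl⟩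
        · rw [t₃ _ _ fun g hg hgb e => hb (hinjR g hg f hf e ▸ hgb), k₂]
    · have h1 := fun f hf => (hU a ha f hf).1
      have h2 := fun f hf => (hU a ha f hf).2
      exact ⟨t₁ x a h2, by rw [t₃ _ a fun f hf _ => h1 f hf, t₂ _ a fun f hf _ => h2 f hf]⟩

/-- The left sums of a tree are computed in logarithmic depth. -/
theorem exists_circuit_isLeftSum (n : ℕ) : ∀ T : KeyTree (Fin N), T.keys.length ≤ n →
    T.keys.Nodup → ∃ C : CNOTCircuit N,
      (C.length : ℝ) ≤ 3 / Real.log (6 / 5) * Real.log T.keys.length ∧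
      (∀ x, ∀ a ∉ T.keys, circuitAct C x a = x a) ∧
      ∀ x, T.IsLeftSum x (circuitAct C x) := by
  have hlog : 0 < Real.log (6 / 5) := Real.log_pos (by norm_num)
  induction n with
  | zero =>
    intro T hT _
    rw [Nat.le_zero, KeyTree.keys_length_eq_zero] at hT
    subst hT
    exact ⟨[], by simp [KeyTree.keys], fun _ _ _ => rfl, fun _ => trivial⟩
  | succ n ih =>
    intro T hT hn
    by_cases h2 : 2 ≤ T.keys.length
    · obtain ⟨T', M, U, h, hM, -⟩ := KeyTree.exists_contracts _ T le_rfl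
      have hM := hM h2
      obtain ⟨hp, hp'⟩ := h.keys_perm
      have hl := hp.length_eq
      have hl' := hp'.length_eq
      simp only [List.length_append, List.length_map] at hl hl'
      obtain ⟨C, hC, hC₁, hC₂⟩ := ih T' (by omega)
        (hp'.symm.nodup ((hp.nodup hn).sublist
          ((List.sublist_append_right _ _).append (List.Sublist.refl _))))
      obtain ⟨L₁, L₂, L₃, hL, hL'⟩ := h.exists_round hn
      have hact : ∀ x, circuitAct (L₁ :: (C ++ [L₂, L₃])) x =
          gatesAct L₃.gates (gatesAct L₂.gates (circuitAct C (gatesAct L₁.gates x))) := by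
        intro x
        simp only [circuitAct, circuitAct_append]
      refine ⟨L₁ :: (C ++ [L₂, L₃]), ?_, fun x a ha => ?_, fun x => ?_⟩
      -- A round removes `M.length` keys, which is at least a sixth; the logarithm drops by `log (6
      -- / 5)`, which pays for three layers.
      · have h5 : (T'.keys.length : ℝ) ≤ 5 / 6 * T.keys.length := by
          have : 6 * T'.keys.length ≤ 5 * T.keys.length := by omega
          have : (6 : ℝ) * T'.keys.length ≤ 5 * T.keys.length := by exact_mod_cast this
          linarith
        have hpos : (2 : ℝ) ≤ T.keys.length := by exact_mod_cast h2
        have h6 : Real.log T'.keys.length ≤ Real.log T.keys.length - Real.log (6 / 5) := by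
          rw [← Real.log_div (by linarith) (by norm_num)]
          rcases Nat.eq_zero_or_pos T'.keys.length with h0 | h0
          -- With the default value `Real.log 0 = 0`, only `6 / 5 ≤ T.keys.length` is needed.
          · rw [h0, Nat.cast_zero, Real.log_zero]
            exact Real.log_nonneg (by linarith)
          · exact Real.log_le_log (by exact_mod_cast h0) (by linarith)
        have h7 := mul_le_mul_of_nonneg_left h6 (div_pos three_pos hlog).le
        rw [mul_sub, div_mul_cancel₀ _ hlog.ne'] at h7
        simp only [List.length_cons, List.length_append, List.length_nil]
        push_cast
        linarith
      · have ha' : a ∉ T'.keys := fun h' => ha (by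
          rw [hp'.mem_iff, List.mem_append] at h'
          rw [hp.mem_iff, List.mem_append, List.mem_append]
          exact h'.imp_left .inr)
        rw [hact, (hL a ha _).2.2, (hL a ha _).2.1, hC₁ _ a ha', (hL a ha _).1]
      · rw [hact]
        exact hL' _ hC₁ hC₂ x
    -- With at most one key the left sum is `x` itself, and the logarithm vanishes (for no key, by
    -- its default value).
    · refine ⟨[], ?_, fun _ _ _ => rfl, fun x => ?_⟩
      · have : T.keys.length = 0 ∨ T.keys.length = 1 := by omega
        rcases this with h | h <;> simp [h]
      · rcases T with _ | ⟨k, l, r⟩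
        · trivial
        · simp only [KeyTree.keys, List.length_append, List.length_cons] at h2
          obtain rfl := KeyTree.keys_length_eq_zero.1 (show l.keys.length = 0 by omega)
          obtain rfl := KeyTree.keys_length_eq_zero.1 (show r.keys.length = 0 by omega)
          simp [KeyTree.IsLeftSum, KeyTree.sum, circuitAct]

end Contraction

/-! ### Pauli strings as bit flips with phases -/

namespace Pauli

/-- Whether the Pauli letter flips the bit. -/
def xBit : Pauli → Fin 2
  | I => 0
  | X => 1
  | Y => 1
  | Z => 0

/-- The factor with which the Pauli letter multiplies the basis state `b`. -/
def phase : Pauli → Fin 2 → ℂ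
  | I, _ => 1
  | X, _ => 1
  | Y, b => Complex.I * (-1) ^ (b : ℕ)
  | Z, b => (-1) ^ (b : ℕ)

theorem toMatrix_apply (p : Pauli) (a b : Fin 2) :
    p.toMatrix a b = if a = b + p.xBit then p.phase b else 0 := by
  cases p <;> fin_cases a <;> fin_cases b <;>
    simp [toMatrix, xBit, phase]

end Pauli

/-- The factor with which a Pauli string multiplies a basis state. -/
noncomputable def pauliPhase {N : ℕ} (P : Fin N → Pauli) (x : Bits N) : ℂ :=
  ∏ k, (P k).phase (x k)

section Paulis

variable {N : ℕ}

theorem pauliOperator_apply (P : Fin N → Pauli) (y x : Bits N) :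
    pauliOperator P y x = if y = x + (fun k => (P k).xBit) then pauliPhase P x else 0 := by
  simp only [pauliOperator, Pauli.toMatrix_apply, pauliPhase]
  rw [Finset.prod_ite_zero]
  simp [funext_iff]

theorem pauliPhase_update (P : Fin N → Pauli) (k : Fin N) (p : Pauli) (hk : P k = Pauli.I)
    (x : Bits N) : pauliPhase (Function.update P k p) x = p.phase (x k) * pauliPhase P x := by
  rw [pauliPhase, pauliPhase, ← Finset.mul_prod_erase _ _ (Finset.mem_univ k),
    ← Finset.mul_prod_erase Finset.univ _ (Finset.mem_univ k), Function.update_self, hk]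
  simp only [Pauli.phase, one_mul]
  congr 1
  refine Finset.prod_congr rfl fun j hj => ?_
  rw [Function.update_of_ne (Finset.ne_of_mem_erase hj)]

theorem neg_one_pow_fin_two_add (a b : Fin 2) :
    (-1 : ℂ) ^ ((a + b : Fin 2) : ℕ) = (-1) ^ (a : ℕ) * (-1) ^ (b : ℕ) := by
  fin_cases a <;> fin_cases b <;> simp

end Paulis

/-! ### Majorana operators in left-sum coordinates -/

namespace TernaryTree

variable {α β : Type}

/-- All middle children are leaves. -/
def MiddleLeaves : TernaryTree α β → Prop
  | leaf _ => True
  | node _ l m r => (∃ j, m = leaf j) ∧ l.MiddleLeaves ∧ r.MiddleLeaves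

/-- The binary subtree. -/
def binaryTree : TernaryTree α β → KeyTree α
  | leaf _ => .nil
  | node k l _ r => .node k l.binaryTree r.binaryTree

theorem binaryQubits_subset (T : TernaryTree α β) : ∀ k ∈ T.binaryQubits, k ∈ T.qubits := by
  induction T with
  | leaf => simp [binaryQubits]
  | node k l m r hl hm hr =>
    intro a ha
    simp only [binaryQubits, qubits, List.mem_cons, List.mem_append] at ha ⊢
    rcases ha with ha | ha | ha
    · exact .inl ha
    · exact .inr (.inl (.inl (hl a ha)))
    · exact .inr (.inr (hr a ha))

/-- A parent in a middle subtree would have its label repeated in the binary subtree, against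
distinctness. -/
theorem middleLeaves_of_subset {T : TernaryTree α β} (hn : T.qubits.Nodup)
    (h : ∀ k ∈ T.qubits, k ∈ T.binaryQubits) : T.MiddleLeaves := by
  induction T with
  | leaf => trivial
  | node k l m r hl hm hr =>
    simp only [qubits, binaryQubits, List.nodup_cons, List.nodup_append, List.mem_append,
      List.mem_cons] at hn h
    obtain ⟨hk, ⟨hln, hmn, hlm⟩, hrn, hlr⟩ := hn
    have bl := l.binaryQubits_subset
    have br := r.binaryQubits_subset
    refine ⟨?_, hl hln fun a ha => ?_, hr hrn fun a ha => ?_⟩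
    · rcases m with j | ⟨c, m₁, m₂, m₃⟩
      · exact ⟨j, rfl⟩
      · have hc : c ∈ (node c m₁ m₂ m₃).qubits := by simp [qubits]
        rcases h c (.inr (.inl (.inr hc))) with rfl | h | h
        · exact absurd (.inl (.inr hc)) hk
        · exact absurd rfl (hlm c (bl c h) c hc)
        · exact absurd rfl (hlr c (.inr hc) c (br c h))
    · rcases h a (.inr (.inl (.inl ha))) with rfl | h | h
      · exact absurd (.inl (.inl ha)) hk
      · exact h
      · exact absurd rfl (hlr a (.inl ha) a (br a h))
    · rcases h a (.inr (.inr ha)) with rfl | h | h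
      · exact absurd (.inr ha) hk
      · exact absurd rfl (hlr a (.inl (bl a h)) a ha)
      · exact h

theorem MiddleLeaves.keys_perm {T : TernaryTree α β} (h : T.MiddleLeaves) :
    T.binaryTree.keys.Perm T.qubits := by
  induction T with
  | leaf => rfl
  | node k l m r hl hm hr =>
    obtain ⟨⟨j, rfl⟩, h1, h2⟩ := h
    simp only [binaryTree, KeyTree.keys, qubits, List.append_nil]
    exact List.perm_middle.trans (((hl h1).append (hr h2)).cons _)

theorem MiddleLeaves.length_leaves {T : TernaryTree α β} (h : T.MiddleLeaves) :
    T.leaves.length = 2 * T.binaryTree.keys.length + 1 := by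
  induction T with
  | leaf => rfl
  | node k l m r hl hm hr =>
    obtain ⟨⟨j, rfl⟩, h1, h2⟩ := h
    simp [binaryTree, KeyTree.keys, leaves, hl h1, hr h2]
    omega

variable [DecidableEq α] [DecidableEq β]

theorem pauliString_of_notMem_qubits (T : TernaryTree α β) (j : β) (k : α)
    (hk : k ∉ T.qubits) : T.pauliString j k = Pauli.I := by
  induction T with
  | leaf => rfl
  | node c l m r hl hm hr =>
    simp only [qubits, List.mem_cons, List.mem_append, not_or] at hk
    simp only [pauliString]
    split_ifs
    · rw [Function.update_of_ne hk.1, hl hk.2.1.1]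
    · rw [Function.update_of_ne hk.1, hm hk.2.1.2]
    · rw [Function.update_of_ne hk.1, hr hk.2.2]
    · rfl

end TernaryTree

/-- The Majorana operators of a tree act on its left sums with factors that do not depend on the
tree. -/
theorem TernaryTree.MiddleLeaves.pauliPhase_eq {N : ℕ} {β : Type} [DecidableEq β]
    {T : TernaryTree (Fin N) β} (h : T.MiddleLeaves) (hn : T.qubits.Nodup)
    {x y : Bits N} (hy : T.binaryTree.IsLeftSum x y) {j : β} (hj : j ∈ T.leaves) :
    pauliPhase (T.pauliString j) y =
      Complex.I ^ (T.leaves.idxOf j % 2) *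
        (-1) ^ ((((T.binaryTree.keys.map x).take ((T.leaves.idxOf j + 1) / 2)).sum : Fin 2) :
          ℕ) := by
  induction T with
  | leaf i =>
    simp only [leaves, List.mem_singleton] at hj
    subst hj
    simp [pauliPhase, pauliString, Pauli.phase, leaves, binaryTree, KeyTree.keys]
  | node k l m r hl hm hr =>
    obtain ⟨⟨i, rfl⟩, h1, h2⟩ := h
    simp only [qubits, List.append_nil, List.nodup_cons, List.mem_append, not_or,
      List.nodup_append] at hn
    obtain ⟨⟨hkl, hkr⟩, hln, hrn, hlr⟩ := hn
    obtain ⟨hk, hyl, hyr⟩ := hy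
    have ll := h1.length_leaves
    have kl : ∀ i, pauliPhase (Function.update (l.pauliString j) k i) y = _ := fun i =>
      pauliPhase_update _ k i (pauliString_of_notMem_qubits l j k hkl) y
    have kr : ∀ i, pauliPhase (Function.update (r.pauliString j) k i) y = _ := fun i =>
      pauliPhase_update _ k i (pauliString_of_notMem_qubits r j k hkr) y
    simp only [leaves, List.mem_append, List.mem_singleton] at hj
    simp only [leaves, binaryTree, KeyTree.keys, pauliString, List.mem_singleton]
    split_ifs with c1 c2 c3
    · rw [kl, hl h1 hln hyl c1, List.append_assoc, List.idxOf_append_of_mem c1, List.map_append,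
        List.take_append_of_le_length]
      · simp [Pauli.phase]
      · have := List.idxOf_lt_length_of_mem c1
        simp only [List.length_map]
        omega
    -- The middle leaf has index `2m + 1`, where `m` is the number of keys on the left; `Y` supplies
    -- the factor `I` and the sign of the prefix ending at `k`.
    · subst c2
      rw [pauliPhase_update _ _ _ rfl, List.idxOf_append_of_mem (by simp),
        List.idxOf_append_of_notMem c1, ll]
      have e1 : (2 * l.binaryTree.keys.length + 1 + List.idxOf j [j]) % 2 = 1 := by simp
      have e2 : (2 * l.binaryTree.keys.length + 1 + List.idxOf j [j] + 1) / 2 =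
        l.binaryTree.keys.length + 1 := by simp; omega
      rw [e1, e2, List.map_append, List.take_append, List.take_of_length_le (by simp)]
      simp [Pauli.phase, pauliPhase, hk, KeyTree.sum_eq]
    -- `Z` contributes the sign of `y k`, the sum over the left subtree and `k`, which extends the
    -- prefix from `r` to the whole tree.
    · rw [kr, hr h2 hrn hyr c3, List.idxOf_append_of_notMem (by simp [c1, c2])]
      simp only [List.length_append, List.length_singleton, ll]
      have e1 : (2 * l.binaryTree.keys.length + 1 + 1 + List.idxOf j r.leaves) % 2 =
        List.idxOf j r.leaves % 2 := by omega
      have e2 : (2 * l.binaryTree.keys.length + 1 + 1 + List.idxOf j r.leaves + 1) / 2 =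
        l.binaryTree.keys.length + (1 + (List.idxOf j r.leaves + 1) / 2) := by omega
      rw [e1, e2, List.map_append, List.take_append,
        List.take_of_length_le (l := l.binaryTree.keys.map x) (by simp)]
      simp only [List.length_map, Nat.add_sub_cancel_left, List.map_cons, add_comm 1,
        List.take_succ_cons, List.sum_append, List.sum_cons, Pauli.phase, hk, KeyTree.sum_eq,
        neg_one_pow_fin_two_add]
      ring
    · tauto

theorem List.sum_map_indicator {α : Type*} (e : α → Fin 2) (l : List α) (p : ℕ)
    (h : ∀ (i : ℕ) (hi : i < l.length), e l[i] = if i = p then 1 else 0) :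
    (l.map e).sum = if p < l.length then 1 else 0 := by
  induction l generalizing p with
  | nil => simp
  | cons a l ih =>
    have h0 := h 0 (by simp)
    have hs : ∀ (i : ℕ) (hi : i < l.length), e l[i] = if i + 1 = p then 1 else 0 :=
      fun i hi => h (i + 1) (by simpa using hi)
    rw [List.map_cons, List.sum_cons]
    rcases p with _ | p
    -- The one was at the head; the out-of-range position `l.length` encodes that the tail is zero.
    · rw [ih l.length fun i hi => by rw [hs i hi, if_neg (by omega), if_neg hi.ne]]
      simpa using h0
    · rw [ih p fun i hi => by simp [hs i hi]]
      simp at h0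
      simp [h0]

theorem KeyTree.isLeftSum_of_eq_zero {V : Type} {T : KeyTree V} {x y : V → Fin 2}
    (hx : ∀ a ∈ T.keys, x a = 0) (hy : ∀ a ∈ T.keys, y a = 0) : T.IsLeftSum x y := by
  have : T.IsLeftSum (fun _ => 0) (fun _ => 0) := by
    clear hx hy
    induction T with
    | nil => trivial
    | node k l r hl hr => exact ⟨by simp [sum_eq], hl, hr⟩
  exact this.congr (fun a ha => (hx a ha).symm) fun a ha => (hy a ha).symm

/-- The bit flips of a Majorana operator are the left sums of a single bit, whose position does
not depend on the tree. -/
theorem TernaryTree.MiddleLeaves.isLeftSum_xBit {N : ℕ} {β : Type} [DecidableEq β]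
    {T : TernaryTree (Fin N) β} (h : T.MiddleLeaves) (hn : T.qubits.Nodup)
    {e : Bits N} {j : β} (hj : j ∈ T.leaves)
    (he : ∀ (i : ℕ) (hi : i < T.binaryTree.keys.length),
      e T.binaryTree.keys[i] = if i = T.leaves.idxOf j / 2 then 1 else 0) :
    T.binaryTree.IsLeftSum e (fun k => (T.pauliString j k).xBit) := by
  induction T with
  | leaf i => trivial
  | node k l m r hl hm hr =>
    obtain ⟨⟨i, rfl⟩, h1, h2⟩ := h
    simp only [qubits, List.append_nil, List.nodup_cons, List.mem_append, not_or,
      List.nodup_append] at hn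
    obtain ⟨⟨hkl, hkr⟩, hln, hrn, hlr⟩ := hn
    have ll := h1.length_leaves
    have lr := h2.length_leaves
    simp only [← h1.keys_perm.mem_iff, ← h2.keys_perm.mem_iff] at hkl hkr hlr
    have nel : ∀ a ∈ l.binaryTree.keys, a ≠ k := fun a ha e => hkl (e ▸ ha)
    have ner : ∀ a ∈ r.binaryTree.keys, a ≠ k := fun a ha e => hkr (e ▸ ha)
    have Il : ∀ a ∈ r.binaryTree.keys, l.pauliString j a = Pauli.I := fun a ha =>
      pauliString_of_notMem_qubits l j a fun h => hlr a (h1.keys_perm.mem_iff.2 h) a ha rfl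
    have Ir : ∀ a ∈ l.binaryTree.keys, r.pauliString j a = Pauli.I := fun a ha =>
      pauliString_of_notMem_qubits r j a fun h => hlr a ha a (h2.keys_perm.mem_iff.2 h) rfl
    simp only [leaves, List.mem_append, List.mem_singleton] at hj
    generalize hp : (node k l (leaf i) r).leaves.idxOf j = p at he
    simp only [binaryTree, KeyTree.keys, List.length_append, List.length_cons] at he
    have hel : ∀ (i : ℕ) (hi : i < l.binaryTree.keys.length),
        e l.binaryTree.keys[i] = if i = p / 2 then 1 else 0 := by
      intro i hi
      rw [← he i (by omega), List.getElem_append_left hi]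
    have hek : e k = if l.binaryTree.keys.length = p / 2 then 1 else 0 := by
      rw [← he _ (by omega), List.getElem_append_right le_rfl]
      simp
    have her : ∀ (i : ℕ) (hi : i < r.binaryTree.keys.length),
        e r.binaryTree.keys[i] = if l.binaryTree.keys.length + 1 + i = p / 2 then 1 else 0 := by
      intro i hi
      rw [← he _ (by omega), List.getElem_append_right (by omega)]
      simp [show l.binaryTree.keys.length + 1 + i - l.binaryTree.keys.length = i + 1 by omega]
    have hsl := (KeyTree.sum_eq e l.binaryTree).trans (List.sum_map_indicator e _ _ hel)
    have zr : p / 2 ≤ l.binaryTree.keys.length → ∀ a ∈ r.binaryTree.keys, e a = 0 := by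
      intro hp' a ha
      obtain ⟨i, hi, rfl⟩ := List.getElem_of_mem ha
      rw [her i hi, if_neg (by omega)]
    have zl : l.binaryTree.keys.length ≤ p / 2 → ∀ a ∈ l.binaryTree.keys, e a = 0 := by
      intro hp' a ha
      obtain ⟨i, hi, rfl⟩ := List.getElem_of_mem ha
      rw [hel i hi, if_neg (by omega)]
    simp only [leaves] at hp
    simp only [binaryTree, pauliString, leaves, List.mem_singleton]
    split_ifs with c1 c2 c3
    · rw [List.append_assoc, List.idxOf_append_of_mem c1] at hp
      have hlt := List.idxOf_lt_length_of_mem c1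
      refine ⟨?_, (hl h1 hln c1 (by rwa [hp])).congr (fun _ _ => rfl) (fun a ha => ?_),
        KeyTree.isLeftSum_of_eq_zero (zr (by omega)) (fun a ha => ?_)⟩
      · simp only [hsl, hek, Function.update_self]
        rcases lt_or_eq_of_le (show p / 2 ≤ l.binaryTree.keys.length by omega) with h | h
        · rw [if_pos h, if_neg (by omega)]; rfl
        · rw [if_neg (by omega), if_pos (by omega)]; rfl
      · simp only [Function.update_of_ne (nel a ha)]
      · simp only [Function.update_of_ne (ner a ha), Il a ha]; rfl
    · subst c2
      rw [List.idxOf_append_of_mem (by simp), List.idxOf_append_of_notMem c1, ll,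
        List.idxOf_cons_self] at hp
      refine ⟨?_, KeyTree.isLeftSum_of_eq_zero (zl (by omega)) (fun a ha => ?_),
        KeyTree.isLeftSum_of_eq_zero (zr (by omega)) (fun a ha => ?_)⟩
      · simp only [hsl, hek, Function.update_self]
        rw [if_neg (by omega), if_pos (by omega)]; rfl
      · simp only [Function.update_of_ne (nel a ha)]; rfl
      · simp only [Function.update_of_ne (ner a ha)]; rfl
    · rw [List.idxOf_append_of_notMem (by simp [c1, c2]), List.length_append,
        List.length_singleton, ll] at hp
      refine ⟨?_, KeyTree.isLeftSum_of_eq_zero (zl (by omega)) (fun a ha => ?_),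
        (hr h2 hrn c3 fun i hi => ?_).congr (fun _ _ => rfl) (fun a ha => ?_)⟩
      · simp only [hsl, hek, Function.update_self]
        rw [if_neg (by omega), if_neg (by omega)]; rfl
      · simp only [Function.update_of_ne (nel a ha), Ir a ha]; rfl
      · rw [her i hi]
        exact if_congr (by omega) rfl rfl
      · simp only [Function.update_of_ne (ner a ha)]
    · simp [c1, c2, c3] at hj

/-! ### Uniqueness of the mapping up to a global phase -/

section Fock

variable {N : ℕ}

/-- The number operators are diagonal. -/
theorem annihilation_conjTranspose_mul (k : Fin N) :
    (annihilation k).conjTranspose * annihilation k =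
      Matrix.diagonal fun x : Bits N => if x k = 1 then (1 : ℂ) else 0 := by
  ext y x
  rw [Matrix.mul_apply]
  simp only [Matrix.conjTranspose_apply, annihilation, Matrix.diagonal_apply]
  by_cases hx : x k = 1
  · rw [Finset.sum_eq_single (Function.update x k 0)]
    · by_cases hyx : y = x
      · subst hyx
        simp [hx, ← mul_pow]
      · rw [if_neg hyx, if_neg, star_zero, zero_mul]
        rintro ⟨hy, h⟩
        apply hyx
        ext1 a
        by_cases ha : a = k
        · subst ha; rw [hx, hy]
        · simpa [ha] using (congrFun h a).symm
    · intro z _ hz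
      simp [hz]
    · simp
  · by_cases hyx : y = x <;> simp [hx, hyx]

/-- A unitary that commutes with all annihilation operators is a scalar. -/
theorem exists_smul_of_commute_annihilation {W : Operator N}
    (hW : W ∈ Matrix.unitaryGroup (Bits N) ℂ)
    (h : ∀ k : Fin N, W * annihilation k = annihilation k * W) :
    ∃ z : ℂ, ‖z‖ = 1 ∧ W = z • (1 : Operator N) := by
  have hW₁ : W.conjTranspose * W = 1 := Matrix.mem_unitaryGroup_iff'.1 hW
  have hW₂ : W * W.conjTranspose = 1 := Matrix.mem_unitaryGroup_iff.1 hW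
  have h' : ∀ k : Fin N, W * (annihilation k).conjTranspose =
      (annihilation k).conjTranspose * W := by
    intro k
    have := congrArg Matrix.conjTranspose (h k)
    rw [Matrix.conjTranspose_mul, Matrix.conjTranspose_mul] at this
    calc W * (annihilation k).conjTranspose
        = W * ((annihilation k).conjTranspose * W.conjTranspose) * W := by
          rw [Matrix.mul_assoc, Matrix.mul_assoc, hW₁, Matrix.mul_one]
      _ = W * (W.conjTranspose * (annihilation k).conjTranspose) * W := by rw [this]
      _ = (annihilation k).conjTranspose * W := by
          rw [← Matrix.mul_assoc, hW₂, Matrix.one_mul]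
  have hn : ∀ k : Fin N, W * Matrix.diagonal (fun x : Bits N => if x k = 1 then (1 : ℂ) else 0) =
      Matrix.diagonal (fun x : Bits N => if x k = 1 then (1 : ℂ) else 0) * W := by
    intro k
    rw [← annihilation_conjTranspose_mul, ← Matrix.mul_assoc, h', Matrix.mul_assoc, h,
      Matrix.mul_assoc]
  -- The number operators separate the basis states, so `W` is diagonal.
  have hoff : ∀ y x, y ≠ x → W y x = 0 := by
    intro y x hyx
    obtain ⟨k, hk⟩ := Function.ne_iff.1 hyx
    have := congrFun (congrFun (hn k) y) x
    rw [Matrix.mul_diagonal, Matrix.diagonal_mul] at this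
    have hc : (y k = 1 ∧ x k ≠ 1) ∨ (y k ≠ 1 ∧ x k = 1) := by
      revert hk; generalize y k = a; generalize x k = b; revert a b; decide
    rcases hc with ⟨h1, h2⟩ | ⟨h1, h2⟩
    · simpa [h1, h2] using this.symm
    · simpa [h1, h2] using this
  -- Annihilating an occupied mode links two diagonal entries; repetition reaches the vacuum entry
  -- `W 0 0`.
  have hstep : ∀ x : Bits N, ∀ k, x k = 1 →
      W (Function.update x k 0) (Function.update x k 0) = W x x := by
    intro x k hk
    have := congrFun (congrFun (h k) (Function.update x k 0)) x
    rw [Matrix.mul_apply, Matrix.mul_apply,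
      Finset.sum_eq_single (Function.update x k 0)
        (fun z _ hz => by rw [hoff _ _ hz.symm, zero_mul]) (by simp),
      Finset.sum_eq_single x (fun z _ hz => by rw [hoff _ _ hz, mul_zero]) (by simp), mul_comm]
      at this
    refine mul_left_cancel₀ ?_ this
    simp [annihilation, hk]
  have hdiag : ∀ (n : ℕ) (x : Bits N), (Finset.univ.filter fun k => x k = 1).card = n →
      W x x = W 0 0 := by
    intro n
    induction n with
    | zero =>
      intro x hx
      have : x = 0 := by
        ext1 k
        have hk : x k ≠ 1 := fun hk => by
          rw [Finset.card_eq_zero] at hx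
          simpa [hx] using (Finset.mem_filter.2 ⟨Finset.mem_univ k, hk⟩ :
            k ∈ Finset.univ.filter fun k => x k = 1)
        revert hk; change x k ≠ 1 → x k = 0; generalize x k = a; revert a; decide
      rw [this]
    | succ n ih =>
      intro x hx
      obtain ⟨k, hk⟩ : (Finset.univ.filter fun k => x k = 1).Nonempty :=
        Finset.card_pos.1 (by omega)
      rw [← hstep x k (Finset.mem_filter.1 hk).2]
      refine ih _ ?_
      have : (Finset.univ.filter fun a => Function.update x k 0 a = 1) =
          (Finset.univ.filter fun a => x a = 1).erase k := by
        ext a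
        by_cases ha : a = k
        · subst ha; simp
        · simp [ha]
      rw [this, Finset.card_erase_of_mem hk, hx, Nat.add_sub_cancel]
  have hWz : W = W 0 0 • (1 : Operator N) := by
    ext y x
    by_cases hyx : y = x
    · subst hyx; simpa using hdiag _ y rfl
    · simp [hoff y x hyx, hyx]
  refine ⟨W 0 0, ?_, hWz⟩
  have := congrFun (congrFun hW₁ 0) 0
  rw [Matrix.mul_apply, Finset.sum_eq_single (0 : Bits N)
    (fun z _ hz => by rw [hoff _ _ hz, mul_zero]) (by simp), Matrix.conjTranspose_apply,
    Matrix.one_apply_eq] at this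
  have h2 := congrArg norm this
  rw [norm_mul, norm_star, norm_one] at h2
  nlinarith [norm_nonneg (W 0 0)]

/-- On states, the transformation of the Majorana operators determines the transformation of the
mappings up to a global phase. -/
theorem transforms_of_majorana {U : Operator N} (hU : U ∈ Matrix.unitaryGroup (Bits N) ℂ)
    {T₁ T₂ : TernaryTreeMapping N} (h : ∀ j, U * T₁.majorana j = T₂.majorana j * U) :
    Transforms U T₁ T₂ := by
  have hU₁ : U * U.conjTranspose = 1 := Matrix.mem_unitaryGroup_iff.1 hU
  refine ⟨fun j => by rw [h, Matrix.mul_assoc, hU₁, Matrix.mul_one], ?_⟩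
  rintro φ₁ φ₂ ⟨u₁, h₁⟩ ⟨u₂, h₂⟩
  have e₁ : φ₂ * φ₂.conjTranspose = 1 := Matrix.mem_unitaryGroup_iff.1 u₂
  have e₂ : φ₂.conjTranspose * φ₂ = 1 := Matrix.mem_unitaryGroup_iff'.1 u₂
  have hW : φ₂.conjTranspose * (U * φ₁) ∈ Matrix.unitaryGroup (Bits N) ℂ :=
    mul_mem (Unitary.star_mem u₂) (mul_mem hU u₁)
  obtain ⟨z, hz, hWz⟩ := exists_smul_of_commute_annihilation hW fun k => by
    set A := (1 / 2 : ℂ) • (T₂.majorana ⟨2 * k, by omega⟩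
        + Complex.I • T₂.majorana ⟨2 * k + 1, by omega⟩) with hA
    have hψ : A * (U * φ₁) = U * φ₁ * annihilation k := by
      rw [Matrix.mul_assoc U, ← h₁ k, ← Matrix.mul_assoc, ← Matrix.mul_assoc]
      congr 1
      simp only [hA, Matrix.smul_mul, Matrix.mul_smul, Matrix.add_mul, Matrix.mul_add, h]
    have hA₂ : φ₂.conjTranspose * A = annihilation k * φ₂.conjTranspose := by
      calc φ₂.conjTranspose * A = φ₂.conjTranspose * (A * φ₂) * φ₂.conjTranspose := by
            rw [Matrix.mul_assoc, Matrix.mul_assoc, e₁, Matrix.mul_one]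
        _ = _ := by rw [h₂ k, ← Matrix.mul_assoc, e₂, Matrix.one_mul]
    rw [Matrix.mul_assoc, ← hψ, ← Matrix.mul_assoc, hA₂, Matrix.mul_assoc]
  have hz0 : z ≠ 0 := fun e => by simp [e] at hz
  refine ⟨z⁻¹, by simp [hz], ?_⟩
  have : U * φ₁ = z • φ₂ := by
    calc U * φ₁ = φ₂ * (φ₂.conjTranspose * (U * φ₁)) := by
          rw [← Matrix.mul_assoc, e₁, Matrix.one_mul]
      _ = _ := by rw [hWz, Matrix.mul_smul, Matrix.mul_one]
  rw [this, smul_smul, inv_mul_cancel₀ hz0, one_smul]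

end Fock

/-! ### Assembly of the circuit -/

section Main

variable {N : ℕ}

theorem TernaryTreeMapping.qubits_nodup (T : TernaryTreeMapping N) : T.tree.qubits.Nodup :=
  List.nodup_iff_count_le_one.2 fun k => (T.qubits_count k).le

theorem TernaryTreeMapping.mem_leaves (T : TernaryTreeMapping N) (j : Fin (2 * N + 1)) :
    j ∈ T.tree.leaves :=
  List.count_pos_iff.1 (by rw [T.leaves_count]; exact one_pos)

/-- The keys of the binary subtree of a binary-shaped mapping enumerate the qubits. -/
theorem TernaryTreeMapping.keys_enumerate (T : TernaryTreeMapping N) (h : T.tree.MiddleLeaves) :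
    T.tree.binaryTree.keys.Nodup ∧ (∀ k, k ∈ T.tree.binaryTree.keys) ∧
      T.tree.binaryTree.keys.length = N := by
  have hn := h.keys_perm.symm.nodup T.qubits_nodup
  have hm : ∀ k, k ∈ T.tree.binaryTree.keys := fun k =>
    h.keys_perm.mem_iff.2 (List.count_pos_iff.1 (by rw [T.qubits_count]; exact one_pos))
  refine ⟨hn, hm, ?_⟩
  have := List.toFinset_card_of_nodup hn
  rwa [Finset.eq_univ_of_forall fun k => List.mem_toFinset.2 (hm k), Finset.card_univ,
    Fintype.card_fin, eq_comm] at this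

/-- A Majorana operator is a translation of basis states with a phase. `circuitAct C` is additive,
so matching the translation vectors (`hx`) and the phases (`hph`) suffices, and both depend only on
the coordinates in symmetric order, which `hC` matches. -/
theorem transforms_of_circuit {T₁ T₂ : TernaryTreeMapping N} (h₁ : T₁.tree.MiddleLeaves)
    (h₂ : T₂.tree.MiddleLeaves) (hl : T₁.tree.leaves = T₂.tree.leaves)
    {C C₁ C₂ : CNOTCircuit N}
    (hC₁ : ∀ x, T₁.tree.binaryTree.IsLeftSum x (circuitAct C₁ x))
    (hC₂ : ∀ x, T₂.tree.binaryTree.IsLeftSum x (circuitAct C₂ x))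
    (hC : ∀ x₁ x₂, T₁.tree.binaryTree.keys.map x₁ = T₂.tree.binaryTree.keys.map x₂ →
      circuitAct C (circuitAct C₁ x₁) = circuitAct C₂ x₂) :
    Transforms C.toOperator T₁ T₂ := by
  obtain ⟨n₁, m₁, l₁⟩ := T₁.keys_enumerate h₁
  obtain ⟨n₂, m₂, l₂⟩ := T₂.keys_enumerate h₂
  refine transforms_of_majorana C.toOperator_mem_unitaryGroup fun j => ?_
  have hx : circuitAct C (fun k => (T₁.tree.pauliString j k).xBit) =
      fun k => (T₂.tree.pauliString j k).xBit := by
    set p := T₁.tree.leaves.idxOf j with hp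
    have key : ∀ T : TernaryTreeMapping N, ∀ h : T.tree.MiddleLeaves,
        T.tree.leaves = T₁.tree.leaves → ∀ D : CNOTCircuit N,
        (∀ x, T.tree.binaryTree.IsLeftSum x (circuitAct D x)) →
        -- For the last leaf `p / 2 = N` is no position: the vector is zero, in accordance with a
        -- string of `Z`s and `I`s.
        circuitAct D (fun a => if T.tree.binaryTree.keys.idxOf a = p / 2 then 1 else 0) =
          fun k => (T.tree.pauliString j k).xBit := by
      intro T h hT D hD
      obtain ⟨n, m, l⟩ := T.keys_enumerate h
      ext1 a
      refine (hD _).unique (h.isLeftSum_xBit T.qubits_nodup (T.mem_leaves j) ?_) a (m a)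
      intro i hi
      simp only [n.idxOf_getElem i hi, hT, hp]
    rw [← key T₁ h₁ rfl C₁ hC₁, ← key T₂ h₂ hl.symm C₂ hC₂]
    refine hC _ _ (List.ext_getElem (by simp [l₁, l₂]) fun i hi hi' => ?_)
    simp only [List.length_map] at hi hi'
    simp [n₁.idxOf_getElem i hi, n₂.idxOf_getElem i hi']
  have hph : ∀ x, pauliPhase (T₁.tree.pauliString j) x =
      pauliPhase (T₂.tree.pauliString j) (circuitAct C x) := by
    intro x
    obtain ⟨x₁, rfl⟩ := circuitAct_surjective C₁ x
    obtain ⟨x₂, hx₂⟩ : ∃ x₂, T₁.tree.binaryTree.keys.map x₁ = T₂.tree.binaryTree.keys.map x₂ := by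
      refine ⟨fun a => (T₁.tree.binaryTree.keys.map x₁).getD
        (T₂.tree.binaryTree.keys.idxOf a) 0, ?_⟩
      refine List.ext_getElem (by simp [l₁, l₂]) fun i hi hi' => ?_
      simp only [List.length_map] at hi hi'
      simp [n₂.idxOf_getElem i hi', hi]
    rw [hC _ _ hx₂, h₁.pauliPhase_eq T₁.qubits_nodup (hC₁ _) (T₁.mem_leaves j),
      h₂.pauliPhase_eq T₂.qubits_nodup (hC₂ _) (T₂.mem_leaves j), hl, hx₂]
  rw [C.toOperator_eq]
  ext y x
  simp only [Matrix.mul_apply, TernaryTreeMapping.majorana, pauliOperator_apply, basisMap,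
    ite_mul, mul_ite, mul_one, mul_zero, one_mul, zero_mul, Finset.sum_ite_eq', Finset.mem_univ, if_true, hph x, ← hx, ← circuitAct_add]

end Main

theorem mainTheorem4 :
    ∃ K : ℝ, ∀ (N : ℕ), 1 ≤ N → ∀ (T₁ T₂ : TernaryTreeMapping N),
      T₁.IsBinaryShaped → T₂.IsBinaryShaped → T₁.tree.leaves = T₂.tree.leaves →
      ∃ C : CNOTCircuit N,
        (C.depth : ℝ) ≤ K * Real.log N ∧ Transforms C.toOperator T₁ T₂ := by
  -- Two left-sum circuits, plus at most six permutation layers, absorbed by `log 2 ≤ log N` when `N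
  -- ≥ 2`.
  refine ⟨2 * (3 / Real.log (6 / 5)) + 6 / Real.log 2, fun N hN T₁ T₂ b₁ b₂ hl => ?_⟩
  have h₁ := TernaryTree.middleLeaves_of_subset T₁.qubits_nodup b₁
  have h₂ := TernaryTree.middleLeaves_of_subset T₂.qubits_nodup b₂
  obtain ⟨n₁, m₁, l₁⟩ := T₁.keys_enumerate h₁
  obtain ⟨n₂, m₂, l₂⟩ := T₂.keys_enumerate h₂
  obtain ⟨C₁, d₁, -, hC₁⟩ := exists_circuit_isLeftSum _ T₁.tree.binaryTree le_rfl n₁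
  obtain ⟨C₂, d₂, -, hC₂⟩ := exists_circuit_isLeftSum _ T₂.tree.binaryTree le_rfl n₂
  let e₁ := n₁.getEquivOfForallMemList _ m₁
  let e₂ := n₂.getEquivOfForallMemList _ m₂
  obtain ⟨P, dP, dP', hP⟩ :=
    -- The permutation runs from the keys of `T₂` to those of `T₁` because the circuit acts by
    -- precomposition.
    exists_circuit_of_perm (e₂.symm.trans ((finCongr (l₂.trans l₁.symm)).trans e₁))
  refine ⟨C₁.reverse ++ (P ++ C₂), ?_, transforms_of_circuit h₁ h₂ hl hC₁ hC₂ ?_⟩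
  · rw [l₁] at d₁
    rw [l₂] at d₂
    simp only [CNOTCircuit.depth, List.length_append, List.length_reverse]
    have hlog2 : 0 < Real.log 2 := Real.log_pos one_lt_two
    have hp : (P.length : ℝ) ≤ 6 / Real.log 2 * Real.log N := by
      rcases hN.eq_or_lt with h | h
      · rw [dP' h.symm, ← h]; simp
      · have h2 : Real.log 2 ≤ Real.log N := Real.log_le_log two_pos (by exact_mod_cast h)
        have h3 := mul_le_mul_of_nonneg_left h2 (div_pos (by norm_num : (0 : ℝ) < 6) hlog2).le
        rw [div_mul_cancel₀ _ hlog2.ne'] at h3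
        have : (P.length : ℝ) ≤ 6 := by exact_mod_cast dP
        linarith
    push_cast
    linarith
  · intro x₁ x₂ hx
    have hPx : circuitAct P x₁ = x₂ := by
      rw [hP]
      ext1 a
      obtain ⟨i, rfl⟩ := e₂.surjective a
      have := List.getElem_of_eq hx (i := i) (by simp [l₁, ← l₂])
      simpa [e₁, e₂, n₂.idxOf_getElem] using this
    have hr : circuitAct C₁.reverse (circuitAct C₁ x₁) = x₁ := circuitAct_reverse C₁ x₁
    rw [circuitAct_append, circuitAct_append, hr, hPx]
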